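/- Let $A$ and $B$ range over finite-dimensional complex Hilbert spaces. A state on $A\otimes B$ is a positive semidefinite operator of trace one. It is separable if it is a convex combination of projectors $|\psi\rangle\langle\psi|$ onto unit product vectors $\psi=a\otimes b$ with $a\in A$, $b\in B$. It is PPT if its partial transpose (the image under the linear map $M\otimes N\mapsto M\otimes N^{T}$, with the transpose taken in a fixed orthonormal basis of $B$) is positive semidefinite. The trace distance of two states is $\|\rho-\sigma\|_{\mathrm{Tr}}=\frac12\mathrm{Tr}|\rho-\sigma|$, where $|X|=\sqrt{X^\dagger X}$. Theorem. For every $\varepsilon>0$ there is an integer $N$, depending only on $\varepsilon$, such that whenever $\dim A\ge N$ and $\dim B\ge N$ there exists a PPT state $\rho$ on $A\otimes B$ whose trace distance from the set of separable states satisfies $$\inf_{\sigma\ \text{separable}}\|\rho-\sigma\|_{\mathrm{Tr}}>1-\varepsilon .$$ -/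

import Mathlib

open scoped ComplexOrder MatrixOrder

noncomputable section

/-- A quantum state (density matrix) on the Hilbert space `ℂ^ι`: a positive semidefinite matrix
of trace one. -/
def IsState {ι : Type*} [Fintype ι] (ρ : Matrix ι ι ℂ) : Prop :=
  ρ.PosSemidef ∧ ρ.trace = 1

/-- The partial transpose on the second subsystem: the linear map with
`(M ⊗ N) ↦ M ⊗ Nᵀ`, written in the standard product basis of `ℂ^A ⊗ ℂ^B = ℂ^(A × B)`. -/
def partialTranspose {A B : Type*} (ρ : Matrix (A × B) (A × B) ℂ) : Matrix (A × B) (A × B) ℂ :=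
  Matrix.of fun p q => ρ (p.1, q.2) (q.1, p.2)

/-- A PPT state: a density matrix whose partial transpose is positive semidefinite. -/
def IsPPT {A B : Type*} [Fintype A] [Fintype B] (ρ : Matrix (A × B) (A × B) ℂ) : Prop :=
  IsState ρ ∧ (partialTranspose ρ).PosSemidef

/-- A separable pure state: a unit vector of `ℂ^A ⊗ ℂ^B` of the form `a ⊗ b`. -/
def IsSeparablePure {A B : Type*} [Fintype A] [Fintype B] (ψ : A × B → ℂ) : Prop :=
  ∑ p, ‖ψ p‖ ^ 2 = 1 ∧ ∃ (a : A → ℂ) (b : B → ℂ), ∀ p, ψ p = a p.1 * b p.2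

/-- The set of separable states: the density matrices which are convex combinations of
projectors `|ψ⟩⟨ψ|` onto separable pure states `ψ`. -/
def separableStates (A B : Type*) [Fintype A] [Fintype B] : Set (Matrix (A × B) (A × B) ℂ) :=
  {σ | IsState σ ∧
    σ ∈ convexHull ℝ {P | ∃ ψ : A × B → ℂ, IsSeparablePure ψ ∧ P = Matrix.vecMulVec ψ (star ψ)}}

/-- The trace distance `½ Tr |ρ - σ|`, where `|X| = √(Xᴴ X)`. -/
def traceDist {ι : Type*} [Fintype ι] [DecidableEq ι] (ρ σ : Matrix ι ι ℂ) : ℝ :=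
  (1 / 2) * (CFC.sqrt ((ρ - σ).conjTranspose * (ρ - σ))).trace.re

/-- The trace distance of `ρ` from the set of separable states. -/
def distSeparable {A B : Type*} [Fintype A] [Fintype B] [DecidableEq A] [DecidableEq B]
    (ρ : Matrix (A × B) (A × B) ℂ) : ℝ :=
  sInf (traceDist ρ '' separableStates A B)

end

/-!
The idea is to find a single PPT state `ρ` and a measurement effect `0 ≤ Q ≤ 1` such that `Q`
accepts `ρ` with certainty, accepts separable states with probability at most some `δ < 1`, and,
crucially, is itself a separable operator (`HasSeparableTest`). Separability of `Q` makes the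
acceptance probability multiplicative: applying `Q` to one part of a product vector leaves a sum of
product vectors on the rest, so `Q ⊗ ⋯ ⊗ Q` accepts separable states with probability at most
`δ ^ n`, while it still accepts the PPT state `ρ ⊗ ⋯ ⊗ ρ` with certainty (`HasSeparableTest.mul`). The
trace distance of that state from the separable states is therefore at least `1 - δ ^ n`
(`HasSeparableTest.exists_isPPT_le_distSeparable`), and embedding by local isometries reaches all
larger dimensions (`HasSeparableTest.of_isometry`).

The starting pair comes from an unextendible product basis: orthonormal real product vectors
`u₁ ⊗ v₁, …, uₖ ⊗ vₖ` such that no product vector is orthogonal to all of them. With `S` the projection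
onto their span, `ρ` is the normalized projection `1 - S`, and `Q = 1 - S / k`. Compactness of the
set of unit product vectors gives `δ < 1`, and `Q` is the average of the separable operators
`1 - pᵢ ⊗ qᵢ`, where `pᵢ` and `qᵢ` are the projections onto `uᵢ` and `vᵢ`
(`exists_hasSeparableTest_of_unextendible`). The Tiles basis of `ℂ³ ⊗ ℂ³` is such a family.
-/

open scoped ComplexOrder MatrixOrder
open scoped Kronecker
open Matrix

/-! ### Trace distance and effects -/

theorem two_mul_trace_mul_le {n : Type*} [Fintype n] [DecidableEq n]
    {X M : Matrix n n ℂ} (hX : X.IsHermitian) (hM : M.PosSemidef) (hM1 : (1 - M).PosSemidef) :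
    2 * (M * X).trace.re ≤ (CFC.sqrt (Xᴴ * X)).trace.re + X.trace.re := by
  have hsa : IsSelfAdjoint X := hX
  have habs : CFC.sqrt (Xᴴ * X) = X⁺ + X⁻ := (CFC.posPart_add_negPart X hsa).symm
  have hX' : X = X⁺ - X⁻ := (CFC.posPart_sub_negPart X hsa).symm
  have hP : (X⁺).PosSemidef := (CFC.posPart_nonneg X).posSemidef
  have hN : (X⁻).PosSemidef := (CFC.negPart_nonneg X).posSemidef
  generalize X⁺ = P at *
  generalize X⁻ = N at *
  -- Positive operators have nonnegative trace pairing, which bounds `M` above on the positive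
  -- part of `X` and below on its negative part.
  have key : ∀ {U V : Matrix n n ℂ}, U.PosSemidef → V.PosSemidef → 0 ≤ (U * V).trace.re := by
    intro U V hU hV
    obtain ⟨C, rfl⟩ := CStarAlgebra.nonneg_iff_eq_star_mul_self.mp hV.nonneg
    rw [star_eq_conjTranspose, ← Matrix.mul_assoc, Matrix.trace_mul_comm, ← Matrix.mul_assoc]
    exact (Complex.le_def.mp (hU.mul_mul_conjTranspose_same C).trace_nonneg).1
  have h1 := key hM1 hP
  have h2 := key hM hN
  rw [habs, hX']
  simp only [Matrix.sub_mul, Matrix.mul_sub, Matrix.one_mul, trace_sub, trace_add, Complex.sub_re,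
    Complex.add_re] at *
  linarith

theorem trace_mul_sub_le_traceDist {n : Type*} [Fintype n] [DecidableEq n]
    {ρ σ M : Matrix n n ℂ} (hρ : IsState ρ) (hσ : IsState σ) (hM : M.PosSemidef)
    (hM1 : (1 - M).PosSemidef) :
    (M * ρ).trace.re - (M * σ).trace.re ≤ traceDist ρ σ := by
  have h := two_mul_trace_mul_le (hρ.1.isHermitian.sub hσ.1.isHermitian) hM hM1
  rw [trace_sub, hρ.2, hσ.2, Matrix.mul_sub, trace_sub] at h
  simp only [sub_self, Complex.zero_re, Complex.sub_re] at h
  rw [traceDist]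
  linarith

/-! ### Separable operators and block positivity -/

section Bipartite

variable {A B A' B' : Type}

/-- The vector `a ⊗ b` of `ℂ^A ⊗ ℂ^B = ℂ^(A × B)`. -/
def productVec (a : A → ℂ) (b : B → ℂ) : A × B → ℂ := fun p => a p.1 * b p.2

/-- The tensor product of an operator on `ℂ^A ⊗ ℂ^B` with one on `ℂ^A' ⊗ ℂ^B'`, regarded as an
operator on `(ℂ^A ⊗ ℂ^A') ⊗ (ℂ^B ⊗ ℂ^B')`, so that the first party holds `A` and `A'`. -/
def bipartiteKronecker (M : Matrix (A × B) (A × B) ℂ) (N : Matrix (A' × B') (A' × B') ℂ) :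
    Matrix ((A × A') × (B × B')) ((A × A') × (B × B')) ℂ :=
  (M ⊗ₖ N).submatrix (Equiv.prodProdProdComm A A' B B') (Equiv.prodProdProdComm A A' B B')

theorem bipartiteKronecker_kronecker (X : Matrix A A ℂ) (Y : Matrix B B ℂ)
    (X' : Matrix A' A' ℂ) (Y' : Matrix B' B' ℂ) :
    bipartiteKronecker (X ⊗ₖ Y) (X' ⊗ₖ Y') = (X ⊗ₖ X') ⊗ₖ (Y ⊗ₖ Y') := by
  ext p q
  simp [bipartiteKronecker, mul_mul_mul_comm]

theorem partialTranspose_bipartiteKronecker (M : Matrix (A × B) (A × B) ℂ)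
    (N : Matrix (A' × B') (A' × B') ℂ) :
    partialTranspose (bipartiteKronecker M N) =
      bipartiteKronecker (partialTranspose M) (partialTranspose N) := rfl

theorem bipartiteKronecker_one [DecidableEq A] [DecidableEq B] [DecidableEq A'] [DecidableEq B'] :
    bipartiteKronecker (1 : Matrix (A × B) (A × B) ℂ) (1 : Matrix (A' × B') (A' × B') ℂ) = 1 := by
  rw [bipartiteKronecker, one_kronecker_one, submatrix_one_equiv]

variable [Fintype A] [Fintype B]

theorem kronecker_mulVec_productVec (V : Matrix A' A ℂ) (U : Matrix B' B ℂ) (a : A → ℂ)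
    (b : B → ℂ) : (V ⊗ₖ U) *ᵥ productVec a b = productVec (V *ᵥ a) (U *ᵥ b) := by
  ext p
  simp only [mulVec, dotProduct, productVec, Fintype.sum_prod_type, kroneckerMap_apply,
    Finset.sum_mul_sum]
  refine Finset.sum_congr rfl fun _ _ => Finset.sum_congr rfl fun _ _ => by ring

theorem partialTranspose_conj_kronecker (V : Matrix A' A ℂ) (U : Matrix B' B ℂ)
    (ρ : Matrix (A × B) (A × B) ℂ) :
    partialTranspose ((V ⊗ₖ U) * ρ * (V ⊗ₖ U)ᴴ) =
      (V ⊗ₖ U.map star) * partialTranspose ρ * (V ⊗ₖ U.map star)ᴴ := by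
  ext p q
  simp only [partialTranspose, of_apply, mul_apply, Finset.sum_mul, Fintype.sum_prod_type,
    kroneckerMap_apply, conjTranspose_apply, star_mul', map_apply, star_star]
  refine Finset.sum_congr rfl fun _ _ => ?_
  rw [Finset.sum_comm]
  conv_rhs => rw [Finset.sum_comm]
  refine Finset.sum_congr rfl fun _ _ => ?_
  rw [Finset.sum_comm]
  refine Finset.sum_congr rfl fun _ _ => Finset.sum_congr rfl fun _ _ => by ring

variable [Fintype A'] [Fintype B']

/-- A separable (unnormalized) operator: a finite sum of tensor products of positive semidefinite
operators. -/
def IsSeparableOperator (Q : Matrix (A × B) (A × B) ℂ) : Prop :=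
  ∃ (J : Type) (_ : Fintype J) (X : J → Matrix A A ℂ) (Y : J → Matrix B B ℂ),
    (∀ j, (X j).PosSemidef) ∧ (∀ j, (Y j).PosSemidef) ∧ Q = ∑ j, X j ⊗ₖ Y j

/-- Block positivity: nonnegative expectation in every product vector. -/
def IsBlockPositive (W : Matrix (A × B) (A × B) ℂ) : Prop :=
  ∀ (a : A → ℂ) (b : B → ℂ), 0 ≤ star (productVec a b) ⬝ᵥ W *ᵥ productVec a b

/-- There are a PPT state `ρ` and a separable effect `0 ≤ Q ≤ 1` which accepts `ρ` with certainty
but accepts product vectors, hence separable states, with probability at most `δ`. -/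
def HasSeparableTest (A B : Type) [Fintype A] [Fintype B] [DecidableEq A] [DecidableEq B]
    (δ : ℝ) : Prop :=
  ∃ ρ Q : Matrix (A × B) (A × B) ℂ, IsPPT ρ ∧ IsSeparableOperator Q ∧ (1 - Q).PosSemidef ∧
    (Q * ρ).trace = 1 ∧ IsBlockPositive (δ • (1 : Matrix (A × B) (A × B) ℂ) - Q)

theorem IsSeparableOperator.posSemidef {Q : Matrix (A × B) (A × B) ℂ}
    (hQ : IsSeparableOperator Q) : Q.PosSemidef := by
  classical
  obtain ⟨J, _, X, Y, hX, hY, rfl⟩ := hQ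
  exact posSemidef_sum _ fun j _ => (hX j).kronecker (hY j)

theorem IsBlockPositive.add {W W' : Matrix (A × B) (A × B) ℂ} (hW : IsBlockPositive W)
    (hW' : IsBlockPositive W') : IsBlockPositive (W + W') := fun a b => by
  rw [add_mulVec, dotProduct_add]
  exact add_nonneg (hW a b) (hW' a b)

theorem IsBlockPositive.smul {W : Matrix (A × B) (A × B) ℂ} (hW : IsBlockPositive W)
    {c : ℝ} (hc : 0 ≤ c) : IsBlockPositive (c • W) := fun a b => by
  rw [smul_mulVec, dotProduct_smul]
  exact smul_nonneg hc (hW a b)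

theorem Matrix.PosSemidef.isBlockPositive {W : Matrix (A × B) (A × B) ℂ}
    (hW : W.PosSemidef) : IsBlockPositive W :=
  fun _ _ => hW.dotProduct_mulVec_nonneg _

/-! ### Tensor products of bipartite operators -/

theorem bipartiteKronecker_mul (M M' : Matrix (A × B) (A × B) ℂ)
    (N N' : Matrix (A' × B') (A' × B') ℂ) :
    bipartiteKronecker M N * bipartiteKronecker M' N' = bipartiteKronecker (M * M') (N * N') := by
  simp [bipartiteKronecker, submatrix_mul_equiv, mul_kronecker_mul]

theorem trace_bipartiteKronecker (M : Matrix (A × B) (A × B) ℂ)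
    (N : Matrix (A' × B') (A' × B') ℂ) :
    (bipartiteKronecker M N).trace = M.trace * N.trace := by
  rw [← trace_kronecker, bipartiteKronecker, trace, trace]
  exact Equiv.sum_comp (Equiv.prodProdProdComm A A' B B') (fun p => (M ⊗ₖ N) p p)

theorem PosSemidef.bipartiteKronecker {M : Matrix (A × B) (A × B) ℂ}
    {N : Matrix (A' × B') (A' × B') ℂ} (hM : M.PosSemidef) (hN : N.PosSemidef) :
    (bipartiteKronecker M N).PosSemidef := by
  classical
  exact (hM.kronecker hN).submatrix _

theorem IsSeparableOperator.bipartiteKronecker {M : Matrix (A × B) (A × B) ℂ}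
    {N : Matrix (A' × B') (A' × B') ℂ} (hM : IsSeparableOperator M)
    (hN : IsSeparableOperator N) : IsSeparableOperator (bipartiteKronecker M N) := by
  classical
  obtain ⟨J, _, X, Y, hX, hY, rfl⟩ := hM
  obtain ⟨J', _, X', Y', hX', hY', rfl⟩ := hN
  refine ⟨J × J', inferInstance, fun j => X j.1 ⊗ₖ X' j.2, fun j => Y j.1 ⊗ₖ Y' j.2,
    fun j => (hX _).kronecker (hX' _), fun j => (hY _).kronecker (hY' _), ?_⟩
  simp_rw [← bipartiteKronecker_kronecker]
  ext p q
  simp only [_root_.bipartiteKronecker, submatrix_apply, kroneckerMap_apply, Matrix.sum_apply,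
    Finset.sum_mul_sum, Fintype.sum_prod_type]

theorem dotProduct_conj_mulVec {ι κ : Type*} [Fintype ι] [Fintype κ] (G : Matrix κ ι ℂ)
    (N : Matrix κ κ ℂ) (φ : ι → ℂ) :
    star φ ⬝ᵥ (Gᴴ * N * G) *ᵥ φ = star (G *ᵥ φ) ⬝ᵥ N *ᵥ (G *ᵥ φ) := by
  rw [star_mulVec, ← mulVec_mulVec, ← mulVec_mulVec, dotProduct_mulVec _ Gᴴ]

theorem dotProduct_kronecker_one_mulVec {ι κ : Type*} [Fintype ι] [Fintype κ] [DecidableEq κ]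
    (M : Matrix ι ι ℂ) (χ : ι × κ → ℂ) :
    star χ ⬝ᵥ (M ⊗ₖ (1 : Matrix κ κ ℂ)) *ᵥ χ =
      ∑ r, star (fun i => χ (i, r)) ⬝ᵥ M *ᵥ (fun i => χ (i, r)) := by
  simp only [dotProduct, mulVec, Fintype.sum_prod_type, kroneckerMap_apply, one_apply,
    Pi.star_apply]
  rw [Finset.sum_comm]
  simp

theorem dotProduct_one_kronecker_mulVec {ι κ : Type*} [Fintype ι] [Fintype κ] [DecidableEq ι]
    (N : Matrix κ κ ℂ) (χ : ι × κ → ℂ) :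
    star χ ⬝ᵥ ((1 : Matrix ι ι ℂ) ⊗ₖ N) *ᵥ χ =
      ∑ i, star (fun k => χ (i, k)) ⬝ᵥ N *ᵥ (fun k => χ (i, k)) := by
  simp only [dotProduct, mulVec, Fintype.sum_prod_type, kroneckerMap_apply, one_apply,
    Pi.star_apply]
  simp [ite_mul, Finset.sum_ite_irrel]

theorem dotProduct_bipartiteKronecker_mulVec (M : Matrix (A × B) (A × B) ℂ)
    (N : Matrix (A' × B') (A' × B') ℂ) (ψ : (A × A') × (B × B') → ℂ) :
    star ψ ⬝ᵥ bipartiteKronecker M N *ᵥ ψ =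
      star (ψ ∘ (Equiv.prodProdProdComm A A' B B').symm) ⬝ᵥ
        (M ⊗ₖ N) *ᵥ (ψ ∘ (Equiv.prodProdProdComm A A' B B').symm) := by
  rw [bipartiteKronecker, submatrix_mulVec_equiv]
  simp only [dotProduct]
  rw [← Equiv.sum_comp (Equiv.prodProdProdComm A A' B B')]
  simp

/-- Separability of the second factor is essential here: contracting a product vector with a
rank-one product term of `Q` leaves a product vector, on which `W` is nonnegative. For `Q` merely
positive semidefinite the conclusion can fail. -/
theorem IsBlockPositive.bipartiteKronecker_separable {W : Matrix (A × B) (A × B) ℂ}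
    {Q : Matrix (A' × B') (A' × B') ℂ} (hW : IsBlockPositive W) (hQ : IsSeparableOperator Q) :
    IsBlockPositive (bipartiteKronecker W Q) := by
  classical
  obtain ⟨J, _, X, Y, hX, hY, rfl⟩ := hQ
  intro a b
  have hsum : bipartiteKronecker W (∑ j, X j ⊗ₖ Y j) = ∑ j, bipartiteKronecker W (X j ⊗ₖ Y j) := by
    ext p q
    simp only [bipartiteKronecker, submatrix_apply, kroneckerMap_apply, Matrix.sum_apply,
      Finset.mul_sum]
  rw [hsum, sum_mulVec, dotProduct_sum]
  refine Finset.sum_nonneg fun j _ => ?_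
  obtain ⟨C, hC⟩ := CStarAlgebra.nonneg_iff_eq_star_mul_self.mp (hX j).nonneg
  obtain ⟨D, hD⟩ := CStarAlgebra.nonneg_iff_eq_star_mul_self.mp (hY j).nonneg
  have hW' : W ⊗ₖ (X j ⊗ₖ Y j) =
      ((1 : Matrix (A × B) (A × B) ℂ) ⊗ₖ (C ⊗ₖ D))ᴴ * (W ⊗ₖ (1 : Matrix (A' × B') (A' × B') ℂ)) *
        ((1 : Matrix (A × B) (A × B) ℂ) ⊗ₖ (C ⊗ₖ D)) := by
    rw [hC, hD, conjTranspose_kronecker, conjTranspose_kronecker, conjTranspose_one,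
      ← mul_kronecker_mul, ← mul_kronecker_mul, Matrix.one_mul, Matrix.mul_one, Matrix.mul_one,
      ← mul_kronecker_mul, star_eq_conjTranspose, star_eq_conjTranspose]
  rw [dotProduct_bipartiteKronecker_mulVec, hW', dotProduct_conj_mulVec,
    dotProduct_kronecker_one_mulVec]
  refine Finset.sum_nonneg fun r _ => ?_
  -- Each contraction of `a ⊗ b` with a row of `C ⊗ D` is again a product vector.
  have hvec : (fun i => ((1 : Matrix (A × B) (A × B) ℂ) ⊗ₖ (C ⊗ₖ D) *ᵥ
      (productVec a b ∘ (Equiv.prodProdProdComm A A' B B').symm)) (i, r)) =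
      productVec (fun x => ∑ x', C r.1 x' * a (x, x')) (fun y => ∑ y', D r.2 y' * b (y, y')) := by
    ext i
    simp only [mulVec, dotProduct, productVec, Function.comp_apply, Fintype.sum_prod_type,
      kroneckerMap_apply, Finset.sum_mul_sum, Equiv.prodProdProdComm_symm,
      Equiv.prodProdProdComm_apply]
    rw [← Fintype.sum_prod_type' (f := fun x y => _), Fintype.sum_eq_single i]
    · refine Finset.sum_congr rfl fun _ _ => Finset.sum_congr rfl fun _ _ => ?_
      rw [one_apply_eq]
      ring
    · intro j hj
      simp [one_apply_ne hj.symm]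
  rw [hvec]
  exact hW _ _

theorem IsBlockPositive.one_bipartiteKronecker [DecidableEq A] [DecidableEq B]
    {W : Matrix (A' × B') (A' × B') ℂ} (hW : IsBlockPositive W) :
    IsBlockPositive (bipartiteKronecker (1 : Matrix (A × B) (A × B) ℂ) W) := by
  intro a b
  rw [dotProduct_bipartiteKronecker_mulVec, dotProduct_one_kronecker_mulVec]
  exact Finset.sum_nonneg fun r _ => hW (fun x => a (r.1, x)) (fun y => b (r.2, y))

variable [DecidableEq A] [DecidableEq B] [DecidableEq A'] [DecidableEq B']

/-! ### Multiplicativity of separable tests -/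

/-- Tests multiply: since `Q'` is separable, entangling the factors of either party across
the two copies does not raise the acceptance probability of a product vector above `δ * δ'`. -/
theorem HasSeparableTest.mul {δ δ' : ℝ} (hδ : 0 ≤ δ) (h : HasSeparableTest A B δ)
    (h' : HasSeparableTest A' B' δ') : HasSeparableTest (A × A') (B × B') (δ * δ') := by
  obtain ⟨ρ, Q, ⟨⟨hρ, hρt⟩, hρΓ⟩, hQ, hQ1, hQρ, hW⟩ := h
  obtain ⟨ρ', Q', ⟨⟨hρ', hρt'⟩, hρΓ'⟩, hQ', hQ1', hQρ', hW'⟩ := h'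
  refine ⟨bipartiteKronecker ρ ρ', bipartiteKronecker Q Q',
    ⟨⟨PosSemidef.bipartiteKronecker hρ hρ', ?_⟩, ?_⟩, hQ.bipartiteKronecker hQ', ?_, ?_, ?_⟩
  · rw [trace_bipartiteKronecker, hρt, hρt', one_mul]
  · rw [partialTranspose_bipartiteKronecker]
    exact PosSemidef.bipartiteKronecker hρΓ hρΓ'
  · have : 1 - bipartiteKronecker Q Q' =
        bipartiteKronecker (1 - Q) 1 + bipartiteKronecker Q (1 - Q') := by
      rw [← bipartiteKronecker_one]
      ext p q
      simp only [bipartiteKronecker, submatrix_apply, kroneckerMap_apply, Matrix.sub_apply,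
        Matrix.add_apply]
      ring
    rw [this]
    exact (PosSemidef.bipartiteKronecker hQ1 PosSemidef.one).add
      (PosSemidef.bipartiteKronecker hQ.posSemidef hQ1')
  · rw [bipartiteKronecker_mul, trace_bipartiteKronecker, hQρ, hQρ', one_mul]
  -- `δδ' - Q ⊗ Q' = (δ - Q) ⊗ Q' + δ (1 ⊗ (δ' - Q'))`, a sum of block positive operators.
  · have : (δ * δ') • 1 - bipartiteKronecker Q Q' =
        bipartiteKronecker (δ • 1 - Q) Q' + δ • bipartiteKronecker 1 (δ' • 1 - Q') := by
      rw [← bipartiteKronecker_one]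
      ext p q
      simp only [bipartiteKronecker, submatrix_apply, kroneckerMap_apply, Matrix.sub_apply,
        Matrix.add_apply, Matrix.smul_apply, Complex.real_smul, Complex.ofReal_mul]
      ring
    rw [this]
    exact (hW.bipartiteKronecker_separable hQ').add (hW'.one_bipartiteKronecker.smul hδ)

/-! ### Isometric embeddings -/

/-- Local isometries embed the test in larger spaces: outside the image the test always rejects. -/
theorem HasSeparableTest.of_isometry {δ : ℝ} (hδ : 0 ≤ δ) (h : HasSeparableTest A B δ)
    {V : Matrix A' A ℂ} {U : Matrix B' B ℂ} (hV : Vᴴ * V = 1) (hU : Uᴴ * U = 1) :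
    HasSeparableTest A' B' δ := by
  obtain ⟨ρ, Q, ⟨⟨hρ, hρt⟩, hρΓ⟩, hQ, hQ1, hQρ, hW⟩ := h
  have hK : (V ⊗ₖ U)ᴴ * (V ⊗ₖ U) = 1 := by
    rw [conjTranspose_kronecker, ← mul_kronecker_mul, hV, hU, one_kronecker_one]
  have hproj : (1 - (V ⊗ₖ U) * (V ⊗ₖ U)ᴴ).PosSemidef := by
    generalize V ⊗ₖ U = K at *
    have : 1 - K * Kᴴ = (1 - K * Kᴴ)ᴴ * (1 - K * Kᴴ) := by
      simp only [conjTranspose_sub, conjTranspose_one, conjTranspose_mul,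
        conjTranspose_conjTranspose, Matrix.sub_mul, Matrix.mul_sub, Matrix.one_mul,
        Matrix.mul_one]
      rw [Matrix.mul_assoc K, ← Matrix.mul_assoc Kᴴ K, hK, Matrix.one_mul]
      abel
    rw [this]
    exact posSemidef_conjTranspose_mul_self _
  have htr : ∀ M : Matrix (A × B) (A × B) ℂ, ((V ⊗ₖ U) * M * (V ⊗ₖ U)ᴴ).trace = M.trace := by
    intro M
    rw [trace_mul_comm, ← Matrix.mul_assoc, hK, Matrix.one_mul]
  refine ⟨(V ⊗ₖ U) * ρ * (V ⊗ₖ U)ᴴ, (V ⊗ₖ U) * Q * (V ⊗ₖ U)ᴴ,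
    ⟨⟨hρ.mul_mul_conjTranspose_same _, (htr _).trans hρt⟩, ?_⟩, ?_, ?_, ?_, ?_⟩
  · rw [partialTranspose_conj_kronecker]
    exact hρΓ.mul_mul_conjTranspose_same _
  · obtain ⟨J, _, X, Y, hX, hY, rfl⟩ := hQ
    refine ⟨J, inferInstance, fun j => V * X j * Vᴴ, fun j => U * Y j * Uᴴ,
      fun j => (hX j).mul_mul_conjTranspose_same _, fun j => (hY j).mul_mul_conjTranspose_same _,
      ?_⟩
    simp only [Matrix.mul_sum, Matrix.sum_mul, conjTranspose_kronecker, mul_kronecker_mul]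
  · have : 1 - (V ⊗ₖ U) * Q * (V ⊗ₖ U)ᴴ =
        (1 - (V ⊗ₖ U) * (V ⊗ₖ U)ᴴ) + (V ⊗ₖ U) * (1 - Q) * (V ⊗ₖ U)ᴴ := by
      simp only [Matrix.mul_sub, Matrix.sub_mul, Matrix.mul_one]
      abel
    rw [this]
    exact hproj.add (hQ1.mul_mul_conjTranspose_same _)
  · have : (V ⊗ₖ U) * Q * (V ⊗ₖ U)ᴴ * ((V ⊗ₖ U) * ρ * (V ⊗ₖ U)ᴴ) =
        (V ⊗ₖ U) * (Q * ρ) * (V ⊗ₖ U)ᴴ := by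
      generalize V ⊗ₖ U = K at *
      calc _ = K * Q * (Kᴴ * K) * ρ * Kᴴ := by simp only [Matrix.mul_assoc]
        _ = _ := by rw [hK, Matrix.mul_one, Matrix.mul_assoc K]
    rw [this, htr, hQρ]
  · have : δ • 1 - (V ⊗ₖ U) * Q * (V ⊗ₖ U)ᴴ =
        δ • (1 - (V ⊗ₖ U) * (V ⊗ₖ U)ᴴ) + (V ⊗ₖ U) * (δ • 1 - Q) * (V ⊗ₖ U)ᴴ := by
      simp only [Matrix.mul_sub, Matrix.sub_mul, Matrix.mul_one, Matrix.mul_smul, Matrix.smul_mul,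
        smul_sub]
      abel
    rw [this]
    refine (hproj.isBlockPositive.smul hδ).add fun a b => ?_
    have h := dotProduct_conj_mulVec (V ⊗ₖ U)ᴴ (δ • 1 - Q) (productVec a b)
    rw [conjTranspose_conjTranspose, conjTranspose_kronecker, kronecker_mulVec_productVec] at h
    rw [conjTranspose_kronecker, h]
    exact hW _ _

theorem HasSeparableTest.of_injective {δ : ℝ} (hδ : 0 ≤ δ) (h : HasSeparableTest A B δ)
    {f : A → A'} {g : B → B'} (hf : f.Injective) (hg : g.Injective) :
    HasSeparableTest A' B' δ := by
  refine h.of_isometry hδ (V := (1 : Matrix A' A' ℂ).submatrix id f)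
    (U := (1 : Matrix B' B' ℂ).submatrix id g) ?_ ?_
  all_goals
    rw [conjTranspose_submatrix, conjTranspose_one,
      ← submatrix_mul _ _ _ _ _ Function.bijective_id, Matrix.one_mul, submatrix_one _ ‹_›]

/-! ### Tensor powers and the distance from the separable states -/

theorem HasSeparableTest.pow {δ : ℝ} (hδ : 0 ≤ δ) {d : ℕ}
    (h : HasSeparableTest (Fin d) (Fin d) δ) (n : ℕ) :
    HasSeparableTest (Fin (d ^ (n + 1))) (Fin (d ^ (n + 1))) (δ ^ (n + 1)) := by
  induction n with
  | zero =>
    rw [zero_add, pow_one δ]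
    exact h.of_injective hδ (Fin.cast_injective (pow_one d).symm)
      (Fin.cast_injective (pow_one d).symm)
  | succ n ih =>
    rw [pow_succ δ, pow_succ d]
    exact (ih.mul (pow_nonneg hδ _) h).of_injective (mul_nonneg (pow_nonneg hδ _) hδ)
      finProdFinEquiv.injective finProdFinEquiv.injective

/-- A state accepted with certainty is at trace distance at least `1 - δ` from every state accepted
with probability at most `δ`. Nonemptiness is needed for the existence of separable states, without
which the infimum is `0`. -/
theorem HasSeparableTest.exists_isPPT_le_distSeparable {δ : ℝ} [Nonempty A] [Nonempty B]
    (h : HasSeparableTest A B δ) :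
    ∃ ρ : Matrix (A × B) (A × B) ℂ, IsPPT ρ ∧ 1 - δ ≤ distSeparable ρ := by
  obtain ⟨ρ, Q, hρ, hQ, hQ1, hQρ, hW⟩ := h
  refine ⟨ρ, hρ, le_csInf ?_ ?_⟩
  · obtain ⟨x⟩ := ‹Nonempty A›
    obtain ⟨y⟩ := ‹Nonempty B›
    refine Set.Nonempty.image _ ⟨vecMulVec (Pi.single (x, y) 1) (star (Pi.single (x, y) 1)),
      ⟨posSemidef_vecMulVec_self_star _, ?_⟩,
      subset_convexHull _ _ ⟨_, ⟨?_, Pi.single x 1, Pi.single y 1, ?_⟩, rfl⟩⟩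
    · simp
    · simp [Pi.single_apply, apply_ite]
    · intro p
      rcases p with ⟨p, q⟩
      by_cases hp : p = x <;> by_cases hq : q = y <;> simp [hp, hq]
  · rintro _ ⟨σ, ⟨hσ, hconv⟩, rfl⟩
    have hle : (Q * σ).trace.re ≤ δ := by
      have hlin : IsLinearMap ℝ fun M : Matrix (A × B) (A × B) ℂ => (Q * M).trace.re :=
        ⟨fun M N => by simp [Matrix.mul_add], fun c M => by simp⟩
      refine convexHull_min ?_ (convex_halfSpace_le hlin δ) hconv
      rintro _ ⟨ψ, ⟨hψ, a, b, hab⟩, rfl⟩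
      have hψ' : ψ = productVec a b := funext hab
      have h := (Complex.le_def.mp (hW a b)).1
      have hn : star ψ ⬝ᵥ ψ = 1 := by
        simp only [dotProduct, Pi.star_apply, RCLike.star_def, Complex.conj_mul']
        exact_mod_cast hψ
      rw [← hψ', sub_mulVec, dotProduct_sub, smul_mulVec, one_mulVec, dotProduct_smul, hn] at h
      simp only [Set.mem_ofPred_eq, mul_vecMulVec, trace_vecMulVec, dotProduct_comm _ (star ψ)]
      simpa using h
    have := trace_mul_sub_le_traceDist hρ.1 hσ hQ.posSemidef hQ1
    rw [hQρ, Complex.one_re] at this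
    linarith

end Bipartite

/-! ### Projections onto real lines -/

/-- The orthogonal projection of `ℂ^n` onto the line spanned by the real vector `u`. The vector is
normalized here, so `u` need only be nonzero; `realProj 0 = 0`. -/
noncomputable def realProj {n : Type*} [Fintype n] (u : n → ℝ) : Matrix n n ℂ :=
  (u ⬝ᵥ u)⁻¹ • vecMulVec (fun x => (u x : ℂ)) (fun x => (u x : ℂ))

section RealProjection

variable {n : Type*} [Fintype n]

theorem realProj_posSemidef (u : n → ℝ) : (realProj u).PosSemidef := by
  have h : star (fun x => (u x : ℂ)) = fun x => (u x : ℂ) := by ext; simp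
  have := posSemidef_vecMulVec_self_star (fun x => (u x : ℂ))
  rw [h] at this
  exact this.smul (inv_nonneg.mpr (Finset.sum_nonneg fun x _ => mul_self_nonneg (u x)))

theorem transpose_realProj (u : n → ℝ) : (realProj u)ᵀ = realProj u := by
  rw [realProj, transpose_smul, transpose_vecMulVec]

theorem realProj_mul_realProj (u v : n → ℝ) :
    realProj u * realProj v = ((u ⬝ᵥ u)⁻¹ * (v ⬝ᵥ v)⁻¹ * (u ⬝ᵥ v)) •
      vecMulVec (fun x => (u x : ℂ)) (fun x => (v x : ℂ)) := by
  have h : (fun x => (u x : ℂ)) ⬝ᵥ (fun x => (v x : ℂ)) = ((u ⬝ᵥ v : ℝ) : ℂ) := by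
    simp [dotProduct]
  rw [realProj, realProj, smul_mul_smul_comm, vecMulVec_mul_vecMulVec, h, vecMulVec_smul,
    Complex.coe_smul, smul_smul]

theorem realProj_mul_of_dotProduct_eq_zero {u v : n → ℝ} (h : u ⬝ᵥ v = 0) :
    realProj u * realProj v = 0 := by
  rw [realProj_mul_realProj, h, mul_zero, zero_smul]

theorem realProj_mul_self {u : n → ℝ} (hu : u ≠ 0) : realProj u * realProj u = realProj u := by
  rw [realProj_mul_realProj, realProj, inv_mul_cancel_right₀ (dotProduct_self_eq_zero.not.mpr hu)]

theorem trace_realProj {u : n → ℝ} (hu : u ≠ 0) : (realProj u).trace = 1 := by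
  have h : (fun x => (u x : ℂ)) ⬝ᵥ (fun x => (u x : ℂ)) = ((u ⬝ᵥ u : ℝ) : ℂ) := by
    simp [dotProduct]
  rw [realProj, trace_smul, trace_vecMulVec, h, Complex.real_smul, ← Complex.ofReal_mul,
    inv_mul_cancel₀ (dotProduct_self_eq_zero.not.mpr hu), Complex.ofReal_one]

theorem posSemidef_one_sub_of_idempotent [DecidableEq n] {P : Matrix n n ℂ} (hP : P.IsHermitian)
    (h : P * P = P) : (1 - P).PosSemidef := by
  have : 1 - P = (1 - P)ᴴ * (1 - P) := by
    rw [conjTranspose_sub, conjTranspose_one, hP.eq]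
    simp [Matrix.sub_mul, Matrix.mul_sub, h]
  rw [this]
  exact posSemidef_conjTranspose_mul_self _

theorem star_dotProduct_realProj_mulVec (u : n → ℝ) (a : n → ℂ) :
    star a ⬝ᵥ realProj u *ᵥ a = (((u ⬝ᵥ u)⁻¹ * ‖∑ x, (u x : ℂ) * a x‖ ^ 2 : ℝ) : ℂ) := by
  have h : star a ⬝ᵥ (fun x => (u x : ℂ)) = star (∑ x, (u x : ℂ) * a x) := by
    simp [dotProduct, mul_comm]
  rw [realProj, smul_mulVec, vecMulVec_mulVec, dotProduct_smul, op_smul_eq_smul, dotProduct_smul, h]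
  simp only [dotProduct, smul_eq_mul, Complex.real_smul]
  push_cast
  rw [RCLike.star_def, Complex.mul_conj']

end RealProjection

/-! ### Unextendible product bases -/

section UnextendibleProductBasis

variable {A B : Type} [Fintype A] [Fintype B]

theorem star_productVec_dotProduct_kronecker_mulVec (X : Matrix A A ℂ) (Y : Matrix B B ℂ)
    (a : A → ℂ) (b : B → ℂ) :
    star (productVec a b) ⬝ᵥ (X ⊗ₖ Y) *ᵥ productVec a b =
      (star a ⬝ᵥ X *ᵥ a) * (star b ⬝ᵥ Y *ᵥ b) := by
  rw [kronecker_mulVec_productVec]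
  simp only [dotProduct, productVec, Fintype.sum_prod_type, Finset.sum_mul_sum, Pi.star_apply,
    star_mul']
  exact Finset.sum_congr rfl fun _ _ => Finset.sum_congr rfl fun _ _ => by ring

theorem star_dotProduct_self_eq {n : Type*} [Fintype n] (a : n → ℂ) :
    star a ⬝ᵥ a = ((∑ x, ‖a x‖ ^ 2 : ℝ) : ℂ) := by
  simp [dotProduct, Complex.conj_mul']

/-- Compactness turns unextendibility into a uniform bound: every unit product vector has overlap at
least `μ > 0` with the span of the product vectors `uᵢ ⊗ vᵢ`. -/
theorem exists_pos_le_sum_of_unextendible {ι : Type*} [Fintype ι] {u : ι → A → ℝ} {v : ι → B → ℝ}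
    (hu : ∀ i, u i ≠ 0) (hv : ∀ i, v i ≠ 0)
    (hext : ∀ (a : A → ℂ) (b : B → ℂ),
      (∀ i, ∑ x, (u i x : ℂ) * a x = 0 ∨ ∑ y, (v i y : ℂ) * b y = 0) → a = 0 ∨ b = 0) :
    ∃ μ : ℝ, 0 < μ ∧ ∀ (a : A → ℂ) (b : B → ℂ),
      μ * ((∑ x, ‖a x‖ ^ 2) * ∑ y, ‖b y‖ ^ 2) ≤
        ∑ i, ((u i ⬝ᵥ u i)⁻¹ * ‖∑ x, (u i x : ℂ) * a x‖ ^ 2) *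
          ((v i ⬝ᵥ v i)⁻¹ * ‖∑ y, (v i y : ℂ) * b y‖ ^ 2) := by
  have hpos : ∀ {n : Type} [Fintype n] {w : n → ℝ}, w ≠ 0 → 0 < (w ⬝ᵥ w)⁻¹ := fun {n _ w} hw =>
    inv_pos.mpr ((Finset.sum_nonneg fun x _ => mul_self_nonneg (w x)).lt_of_ne'
      (dotProduct_self_eq_zero.not.mpr hw))
  set F : EuclideanSpace ℂ A × EuclideanSpace ℂ B → ℝ := fun p =>
    ∑ i, ((u i ⬝ᵥ u i)⁻¹ * ‖∑ x, (u i x : ℂ) * p.1 x‖ ^ 2) *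
      ((v i ⬝ᵥ v i)⁻¹ * ‖∑ y, (v i y : ℂ) * p.2 y‖ ^ 2) with hF
  have hcont : Continuous F := by fun_prop
  have hterm : ∀ (p : EuclideanSpace ℂ A × EuclideanSpace ℂ B) i,
      0 ≤ ((u i ⬝ᵥ u i)⁻¹ * ‖∑ x, (u i x : ℂ) * p.1 x‖ ^ 2) *
        ((v i ⬝ᵥ v i)⁻¹ * ‖∑ y, (v i y : ℂ) * p.2 y‖ ^ 2) :=
    fun p i => mul_nonneg (mul_nonneg (hpos (hu i)).le (sq_nonneg _))
      (mul_nonneg (hpos (hv i)).le (sq_nonneg _))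
  obtain ⟨μ, hμ, hmin⟩ := ((isCompact_sphere (0 : EuclideanSpace ℂ A) 1).prod
    (isCompact_sphere (0 : EuclideanSpace ℂ B) 1)).exists_forall_le' (a := 0)
    hcont.continuousOn (by
      rintro ⟨a, b⟩ ⟨ha, hb⟩
      refine (Finset.sum_nonneg fun i _ => hterm _ i).lt_of_ne' fun h0 => ?_
      rw [Finset.sum_eq_zero_iff_of_nonneg fun i _ => hterm _ i] at h0
      have := hext a b fun i => by
        have := h0 i (Finset.mem_univ i)
        simpa [(hpos (hu i)).ne', (hpos (hv i)).ne', dotProduct_self_eq_zero, hu i, hv i] using this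
      rcases this with h | h
      · have : a = 0 := by ext x; exact congrFun h x
        simp [this] at ha
      · have : b = 0 := by ext x; exact congrFun h x
        simp [this] at hb)
  refine ⟨μ, hμ, fun a b => ?_⟩
  -- Homogeneity reduces the bound to the compact product of unit spheres.
  have hsq : ∀ {n : Type} [Fintype n] (w : n → ℂ), ∑ x, ‖w x‖ ^ 2 = ‖WithLp.toLp 2 w‖ ^ 2 :=
    fun w => (EuclideanSpace.norm_sq_eq _).symm
  rw [hsq, hsq]
  by_cases ha : WithLp.toLp 2 a = 0
  · rw [ha]
    simpa using Finset.sum_nonneg fun i _ => hterm (WithLp.toLp 2 a, WithLp.toLp 2 b) i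
  by_cases hb : WithLp.toLp 2 b = 0
  · rw [hb]
    simpa using Finset.sum_nonneg fun i _ => hterm (WithLp.toLp 2 a, WithLp.toLp 2 b) i
  have ha' := norm_pos_iff.mpr ha
  have hb' := norm_pos_iff.mpr hb
  set s := ‖WithLp.toLp 2 a‖
  set t := ‖WithLp.toLp 2 b‖
  have h := hmin (((s⁻¹ : ℝ) : ℂ) • WithLp.toLp 2 a, ((t⁻¹ : ℝ) : ℂ) • WithLp.toLp 2 b)
    ⟨by simp [norm_smul, s, ha], by simp [norm_smul, t, hb]⟩
  have hscale : ∀ {n : Type} [Fintype n] (w : n → ℝ) (c : n → ℂ) (r : ℝ),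
      ‖∑ x, (w x : ℂ) * ((r : ℂ) * c x)‖ ^ 2 = r ^ 2 * ‖∑ x, (w x : ℂ) * c x‖ ^ 2 := by
    intro n _ w c r
    simp_rw [mul_left_comm _ (r : ℂ), ← Finset.mul_sum]
    rw [norm_mul, mul_pow, Complex.norm_real, Real.norm_eq_abs, sq_abs]
  simp only [hF, PiLp.smul_apply, smul_eq_mul, hscale] at h
  have h2 : ∀ x y z w : ℝ, (x * (s⁻¹ ^ 2 * y)) * (z * (t⁻¹ ^ 2 * w)) =
      (s ^ 2 * t ^ 2)⁻¹ * ((x * y) * (z * w)) := by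
    intro x y z w
    field_simp
  simp only [h2, ← Finset.mul_sum] at h
  rwa [← div_eq_inv_mul, le_div_iff₀ (by positivity)] at h

variable [DecidableEq A] [DecidableEq B]

/-- A real orthogonal unextendible product basis which does not span the whole space yields a PPT
state with a separable test. Let `S` be the projection onto the span of the `k` product vectors. The
state is the normalized projection `1 - S`; it equals its own partial transpose because the vectors
are real. The test is `1 - S / k`, which accepts that state with certainty. -/
theorem exists_hasSeparableTest_of_unextendible {ι : Type} [Fintype ι] [Nonempty ι]
    {u : ι → A → ℝ} {v : ι → B → ℝ} (hu : ∀ i, u i ≠ 0) (hv : ∀ i, v i ≠ 0)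
    (horth : Pairwise fun i j => u i ⬝ᵥ u j = 0 ∨ v i ⬝ᵥ v j = 0)
    (hext : ∀ (a : A → ℂ) (b : B → ℂ),
      (∀ i, ∑ x, (u i x : ℂ) * a x = 0 ∨ ∑ y, (v i y : ℂ) * b y = 0) → a = 0 ∨ b = 0)
    (hcard : Fintype.card ι < Fintype.card A * Fintype.card B) :
    ∃ δ : ℝ, 0 ≤ δ ∧ δ < 1 ∧ HasSeparableTest A B δ := by
  classical
  obtain ⟨μ₀, hμ₀, hμle₀⟩ := exists_pos_le_sum_of_unextendible hu hv hext
  -- Capping `μ` at `1` keeps the value `1 - μ / k` of the test nonnegative.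
  obtain ⟨μ, hμ, hμ1, hμle⟩ : ∃ μ : ℝ, 0 < μ ∧ μ ≤ 1 ∧ ∀ (a : A → ℂ) (b : B → ℂ),
      μ * ((∑ x, ‖a x‖ ^ 2) * ∑ y, ‖b y‖ ^ 2) ≤
        ∑ i, ((u i ⬝ᵥ u i)⁻¹ * ‖∑ x, (u i x : ℂ) * a x‖ ^ 2) *
          ((v i ⬝ᵥ v i)⁻¹ * ‖∑ y, (v i y : ℂ) * b y‖ ^ 2) :=
    ⟨min μ₀ 1, lt_min hμ₀ one_pos, min_le_right _ _, fun a b =>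
      (mul_le_mul_of_nonneg_right (min_le_left _ _) (by positivity)).trans (hμle₀ a b)⟩
  set P : ι → Matrix (A × B) (A × B) ℂ := fun i => realProj (u i) ⊗ₖ realProj (v i) with hP
  set S := ∑ i, P i with hS
  have hPpos : ∀ i, (P i).PosSemidef := fun i =>
    (realProj_posSemidef _).kronecker (realProj_posSemidef _)
  have hSpos : S.PosSemidef := posSemidef_sum _ fun i _ => hPpos i
  have hPP : ∀ i j, P i * P j = if i = j then P i else 0 := by
    intro i j
    simp only [hP, ← mul_kronecker_mul]
    split_ifs with hij
    · subst hij
      rw [realProj_mul_self (hu i), realProj_mul_self (hv i)]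
    · rcases horth hij with h | h
      · rw [realProj_mul_of_dotProduct_eq_zero h, zero_kronecker]
      · rw [realProj_mul_of_dotProduct_eq_zero h, kronecker_zero]
  have hSS : S * S = S := by
    simp [hS, Finset.sum_mul_sum, hPP]
  have hSt : S.trace = Fintype.card ι := by
    simp [hS, hP, trace_sum, trace_kronecker, trace_realProj, hu, hv]
  have hST : partialTranspose S = S := by
    ext p q
    simp only [partialTranspose, of_apply, hS, hP, Matrix.sum_apply, kroneckerMap_apply]
    refine Finset.sum_congr rfl fun i _ => ?_
    congr 1
    exact congrFun₂ (transpose_realProj (v i)) p.2 q.2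
  have h1T : partialTranspose (1 : Matrix (A × B) (A × B) ℂ) = 1 := by
    ext ⟨p, p'⟩ ⟨q, q'⟩
    simp [partialTranspose, one_apply, eq_comm]
  have h1S := posSemidef_one_sub_of_idempotent hSpos.isHermitian hSS
  obtain ⟨k, hkdef⟩ : ∃ k : ℝ, k = Fintype.card ι := ⟨_, rfl⟩
  have hk : 0 < k := by rw [hkdef]; exact_mod_cast Fintype.card_pos
  set d : ℝ := Fintype.card A * Fintype.card B - k with hddef
  have hd : 0 < d := sub_pos.mpr (by rw [hkdef]; exact_mod_cast hcard)
  have htr : (d⁻¹ • (1 - S)).trace = 1 := by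
    rw [trace_smul, trace_sub, trace_one, hSt, Fintype.card_prod, Complex.real_smul]
    have : (((Fintype.card A * Fintype.card B : ℕ) : ℂ) - (Fintype.card ι : ℂ)) = (d : ℂ) := by
      simp [hddef, hkdef]
    rw [this, ← Complex.ofReal_mul, inv_mul_cancel₀ hd.ne', Complex.ofReal_one]
  refine ⟨1 - k⁻¹ * μ, ?_, ?_, d⁻¹ • (1 - S), 1 - k⁻¹ • S,
    ⟨⟨h1S.smul (inv_nonneg.mpr hd.le), htr⟩, ?_⟩, ?_, ?_, ?_, ?_⟩
  · have : 1 ≤ k := by rw [hkdef]; exact_mod_cast (Fintype.card_pos : 0 < Fintype.card ι)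
    nlinarith [inv_le_one_of_one_le₀ this, inv_pos.mpr hk]
  · have := mul_pos (inv_pos.mpr hk) hμ
    linarith
  · have : partialTranspose (d⁻¹ • (1 - S)) = d⁻¹ • (partialTranspose 1 - partialTranspose S) := rfl
    rw [this, h1T, hST]
    exact h1S.smul (inv_nonneg.mpr hd.le)
  -- `1 - S / k` averages the tests `1 - |u ⊗ v⟩⟨u ⊗ v|`, each of which is separable since
  -- `1 - p ⊗ q = (1 - p) ⊗ 1 + p ⊗ (1 - q)` for projections `p`, `q`.
  · refine ⟨ι ⊕ ι, inferInstance,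
      Sum.elim (fun i => k⁻¹ • (1 - realProj (u i))) (fun i => k⁻¹ • realProj (u i)),
      Sum.elim (fun i => 1) (fun i => 1 - realProj (v i)), ?_, ?_, ?_⟩
    · rintro (i | i)
      · exact (posSemidef_one_sub_of_idempotent (realProj_posSemidef _).isHermitian
          (realProj_mul_self (hu i))).smul (inv_nonneg.mpr hk.le)
      · exact (realProj_posSemidef _).smul (inv_nonneg.mpr hk.le)
    · rintro (i | i)
      · exact PosSemidef.one
      · exact posSemidef_one_sub_of_idempotent (realProj_posSemidef _).isHermitian
          (realProj_mul_self (hv i))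
    · have hi : ∀ i, (k⁻¹ • (1 - realProj (u i))) ⊗ₖ (1 : Matrix B B ℂ) +
          (k⁻¹ • realProj (u i)) ⊗ₖ (1 - realProj (v i)) = k⁻¹ • (1 - P i) := by
        intro i
        rw [hP, ← one_kronecker_one]
        ext p q
        simp only [kroneckerMap_apply, Matrix.add_apply, Matrix.smul_apply, Matrix.sub_apply,
          Complex.real_smul]
        ring
      rw [Fintype.sum_sum_type]
      simp only [Sum.elim_inl, Sum.elim_inr]
      rw [← Finset.sum_add_distrib]
      simp_rw [hi]
      rw [← Finset.smul_sum, Finset.sum_sub_distrib, smul_sub, ← hS, Finset.sum_const,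
        Finset.card_univ, ← Nat.cast_smul_eq_nsmul ℝ, ← hkdef, smul_smul, inv_mul_cancel₀ hk.ne',
        one_smul]
  · rw [sub_sub_cancel]
    exact hSpos.smul (inv_nonneg.mpr hk.le)
  · have : (1 - k⁻¹ • S) * (d⁻¹ • (1 - S)) = d⁻¹ • (1 - S) := by
      simp [Matrix.sub_mul, Matrix.mul_sub, hSS]
    rw [this, htr]
  · intro a b
    have hW : (1 - k⁻¹ * μ) • (1 : Matrix (A × B) (A × B) ℂ) - (1 - k⁻¹ • S) =
        k⁻¹ • (S - μ • ((1 : Matrix A A ℂ) ⊗ₖ (1 : Matrix B B ℂ))) := by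
      rw [one_kronecker_one]
      module
    rw [hW, smul_mulVec, dotProduct_smul]
    refine smul_nonneg (inv_nonneg.mpr hk.le) ?_
    rw [sub_mulVec, dotProduct_sub, hS, sum_mulVec, dotProduct_sum, smul_mulVec, dotProduct_smul]
    simp only [hP, star_productVec_dotProduct_kronecker_mulVec, star_dotProduct_realProj_mulVec,
      one_mulVec, star_dotProduct_self_eq, Complex.real_smul]
    rw [sub_nonneg]
    exact_mod_cast hμle a b

end UnextendibleProductBasis

/-! ### The Tiles basis of `ℂ³ ⊗ ℂ³` -/

/-- The first tensor factors of the (unnormalized) Tiles unextendible product basis. -/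
def tilesLeft : Fin 5 → Fin 3 → ℝ :=
  ![![1, 0, 0], ![0, 0, 1], ![1, -1, 0], ![0, 1, -1], ![1, 1, 1]]

/-- The second tensor factors of the (unnormalized) Tiles unextendible product basis. -/
def tilesRight : Fin 5 → Fin 3 → ℝ :=
  ![![1, -1, 0], ![0, 1, -1], ![0, 0, 1], ![1, 0, 0], ![1, 1, 1]]

/-- Any three of the five left factors span `ℂ³`, and so do any three of the right factors; a
product vector orthogonal to all five would have one of its factors orthogonal to three of them. -/
theorem tiles_unextendible (a b : Fin 3 → ℂ)
    (h : ∀ i, ∑ x, (tilesLeft i x : ℂ) * a x = 0 ∨ ∑ y, (tilesRight i y : ℂ) * b y = 0) :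
    a = 0 ∨ b = 0 := by
  have h0 := h 0
  have h1 := h 1
  have h2 := h 2
  have h3 := h 3
  have h4 := h 4
  simp [tilesLeft, tilesRight, Fin.sum_univ_three] at h0 h1 h2 h3 h4
  have ha : a = 0 ↔ a 0 = 0 ∧ a 1 = 0 ∧ a 2 = 0 := by
    simp [funext_iff, Fin.forall_fin_succ]
  have hb : b = 0 ↔ b 0 = 0 ∧ b 1 = 0 ∧ b 2 = 0 := by
    simp [funext_iff, Fin.forall_fin_succ]
  rw [ha, hb]
  grind

theorem tiles_orthogonal :
    Pairwise fun i j => tilesLeft i ⬝ᵥ tilesLeft j = 0 ∨ tilesRight i ⬝ᵥ tilesRight j = 0 := by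
  intro i j hij
  fin_cases i <;> fin_cases j <;>
    simp [tilesLeft, tilesRight, dotProduct, Fin.sum_univ_three] at hij ⊢

theorem tilesLeft_ne_zero (i : Fin 5) : tilesLeft i ≠ 0 := by
  intro h
  have h0 := congrFun h 0
  have h1 := congrFun h 1
  have h2 := congrFun h 2
  fin_cases i <;> simp [tilesLeft] at h0 h1 h2

theorem tilesRight_ne_zero (i : Fin 5) : tilesRight i ≠ 0 := by
  intro h
  have h0 := congrFun h 0
  have h1 := congrFun h 1
  have h2 := congrFun h 2
  fin_cases i <;> simp [tilesRight] at h0 h1 h2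

theorem theorem1 (ε : ℝ) (hε : 0 < ε) :
    ∃ N : ℕ, ∀ dA dB : ℕ, N ≤ dA → N ≤ dB →
      ∃ ρ : Matrix (Fin dA × Fin dB) (Fin dA × Fin dB) ℂ,
        IsPPT ρ ∧ 1 - ε < distSeparable ρ := by
  obtain ⟨δ, hδ, hδ1, h⟩ := exists_hasSeparableTest_of_unextendible tilesLeft_ne_zero
    tilesRight_ne_zero tiles_orthogonal tiles_unextendible (by simp)
  obtain ⟨n, hn⟩ := exists_pow_lt_of_lt_one hε hδ1
  refine ⟨3 ^ (n + 1), fun dA dB hA hB => ?_⟩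
  have hpos : 0 < 3 ^ (n + 1) := by positivity
  have : Nonempty (Fin dA) := ⟨⟨0, hpos.trans_le hA⟩⟩
  have : Nonempty (Fin dB) := ⟨⟨0, hpos.trans_le hB⟩⟩
  obtain ⟨ρ, hρ, hdist⟩ := ((h.pow hδ n).of_injective (pow_nonneg hδ _)
    (Fin.castLE_injective hA) (Fin.castLE_injective hB)).exists_isPPT_le_distSeparable
  have : δ ^ (n + 1) ≤ δ ^ n := pow_le_pow_of_le_one hδ hδ1.le n.le_succ
  exact ⟨ρ, hρ, by linarith⟩
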